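/- All graphs are finite and simple. The Kneser cube $Kn_n$ is the graph whose vertices are all subsets of $[n]=\{1,\dots,n\}$, two distinct vertices $F,F'$ being adjacent if and only if $F\cap F'=\emptyset$. For a graph $G$, let $\mathrm{vex}(n,G)$ be the largest size of a family $\mathcal F\subseteq 2^{[n]}$ such that the induced subgraph $Kn_n[\mathcal F]$ is $G$-free, i.e. does not contain $G$ as a (not necessarily induced) subgraph. A family $\mathcal G\subseteq 2^{[n]}$ is a copy of a poset $(P,\prec)$ if there is a bijection $b:P\to\mathcal G$ such that $p\prec q$ implies $b(p)\subseteq b(q)$; a family is $P$-free if no subfamily of it is a copy of $P$. Let $e(P)$ be the largest integer $k$ such that for all $n$ and $0\le j<n$ the family $\bigcup_{i=1}^{k}\binom{[n]}{j+i}$ is $P$-free. For a bipartite graph $G=(A,B,E)$, let $P_{G,A}$ be the poset whose Hasse diagram is $G$ with every edge oriented (upwards) towards its end-vertex in $A$. For $\mathcal F\subseteq 2^{[n]}$ let $\mathcal U(\mathcal F)=\{H\subseteq[n]:\exists F\in\mathcal F,\ F\subseteq H\}$. **Corollary.** Let $G=(A,B,E)$ be a bipartite graph with $e(P_{G,A})=2$.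 Then, as $n\to\infty$, $$\mathrm{vex}(n,G)=2^{n-1}+(1+o(1))\binom{n}{\lfloor n/2\rfloor}.$$ Moreover, the lower bound is given by the following families. For odd $n$ let $\mathcal F_n=\mathcal U\left(\binom{[n]}{\lfloor n/2\rfloor}\cup\binom{[n]}{\lceil n/2\rceil}\right)$, and for even $n\ge 2$ let $$\mathcal F_n=\mathcal U\left(\{F\subseteq[n]:1\in F,\ |F|\in\{n/2-1,\,n/2\}\}\cup\{F\subseteq[n]:1\notin F,\ |F|\in\{n/2,\,n/2+1\}\}\right).$$ Then for every $n\ge 1$ the graph $Kn_n[\mathcal F_n]$ is $G$-free, and $|\mathcal F_n|=2^{n-1}+(1+o(1))\binom{n}{\lfloor n/2\rfloor}$ as $n\to\infty$. -/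

import Mathlib

open Filter Topology

/-- The Kneser cube: its vertices are the subsets of an `n`-element ground set (`Fin n` stands for
`{1, …, n}`), and two distinct vertices are adjacent if and only if they are disjoint. -/
def kneserCube (n : ℕ) : SimpleGraph (Finset (Fin n)) where
  Adj F F' := F ≠ F' ∧ Disjoint F F'
  symm := ⟨fun _ _ h => ⟨h.1.symm, h.2.symm⟩⟩
  loopless := ⟨fun _ h => h.1 rfl⟩

/-- The family `𝓕` of vertices of the Kneser cube induces a `G`-free subgraph (`G` is not
contained in it as a, not necessarily induced, subgraph). -/
def InducesFree {V : Type*} (G : SimpleGraph V) {n : ℕ} (𝓕 : Finset (Finset (Fin n))) : Prop :=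
  G.Free ((kneserCube n).induce (𝓕 : Set (Finset (Fin n))))

/-- The largest number of vertices of the Kneser cube that induce a `G`-free subgraph. -/
noncomputable def vex {V : Type*} (n : ℕ) (G : SimpleGraph V) : ℕ :=
  sSup {m : ℕ | ∃ 𝓕 : Finset (Finset (Fin n)), InducesFree G 𝓕 ∧ 𝓕.card = m}

/-- The supremum in the definition of `vex` is a maximum as soon as `G` has a vertex. -/
theorem isGreatest_vex {V : Type*} [Nonempty V] (n : ℕ) (G : SimpleGraph V) :
    IsGreatest {m : ℕ | ∃ 𝓕 : Finset (Finset (Fin n)), InducesFree G 𝓕 ∧ 𝓕.card = m}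
      (vex n G) := by
  have hb : BddAbove {m : ℕ | ∃ 𝓕 : Finset (Finset (Fin n)), InducesFree G 𝓕 ∧ 𝓕.card = m} := by
    refine ⟨Fintype.card (Finset (Fin n)), ?_⟩
    rintro m ⟨𝓕, -, rfl⟩
    exact 𝓕.card_le_univ
  refine ⟨Nat.sSup_mem ⟨0, ∅, ?_, rfl⟩ hb, fun m hm => le_csSup hb hm⟩
  rintro ⟨f⟩
  have h := (f (Classical.arbitrary V)).2
  simp at h

/-- The poset whose Hasse diagram is the bipartite graph `G` with parts `A` and `B`, every edge
being oriented (upwards) towards its end-vertex in `A`. -/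
abbrev bipartitePoset {V : Type*} (G : SimpleGraph V) (A B : Set V) (hG : G.IsBipartiteWith A B) :
    PartialOrder V where
  le p q := p = q ∨ (G.Adj p q ∧ q ∈ A)
  le_refl p := Or.inl rfl
  le_trans p q r hpq hqr := by
    rcases hpq with rfl | ⟨h1, h2⟩
    · exact hqr
    · rcases hqr with rfl | ⟨h3, h4⟩
      · exact Or.inr ⟨h1, h2⟩
      · exact absurd h4 (Set.disjoint_right.mp hG.disjoint (hG.mem_of_mem_adj h2 h3))
  le_antisymm p q hpq hqp := by
    rcases hpq with h | ⟨h1, h2⟩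
    · exact h
    · rcases hqp with h | ⟨h3, h4⟩
      · exact h.symm
      · exact absurd h4 (Set.disjoint_right.mp hG.disjoint (hG.mem_of_mem_adj h2 h3))

/-- The strict order of `bipartitePoset` consists of the oriented edges of `G`. -/
theorem bipartitePoset_lt_iff {V : Type*} (G : SimpleGraph V) (A B : Set V)
    (hG : G.IsBipartiteWith A B) (p q : V) :
    (bipartitePoset G A B hG).lt p q ↔ G.Adj p q ∧ q ∈ A := by
  let _ := bipartitePoset G A B hG
  change p < q ↔ _
  rw [lt_iff_le_and_ne]
  constructor
  · rintro ⟨h | h, hne⟩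
    · exact absurd h hne
    · exact h
  · exact fun h => ⟨Or.inr h, h.1.ne⟩

/-- The family `𝓖` is a (weak, that is, not necessarily induced) copy of the poset `P`: there is a
bijection from `P` onto `𝓖` that maps strict relations to inclusions. -/
def IsPosetCopy {V : Type*} (P : PartialOrder V) {n : ℕ} (𝓖 : Finset (Finset (Fin n))) : Prop :=
  ∃ b : V ≃ 𝓖, ∀ p q : V, P.lt p q → (b p : Finset (Fin n)) ⊆ (b q : Finset (Fin n))

/-- The family `𝓕` is `P`-free: no subfamily of it is a copy of `P`. -/
def PosetFree {V : Type*} (P : PartialOrder V) {n : ℕ} (𝓕 : Finset (Finset (Fin n))) : Prop :=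
  ∀ 𝓖 ⊆ 𝓕, ¬ IsPosetCopy P 𝓖

/-- The `k` consecutive levels `j + 1, …, j + k` of the Boolean cube on `n` points. -/
def levels (n j k : ℕ) : Finset (Finset (Fin n)) :=
  Finset.univ.filter fun F => j + 1 ≤ F.card ∧ F.card ≤ j + k

/-- `k` is the number `e(P)`: the largest integer `k` such that, in every Boolean cube, any `k`
consecutive levels form a `P`-free family. -/
def IsLevelNumber {V : Type*} (P : PartialOrder V) (k : ℕ) : Prop :=
  IsGreatest {k : ℕ | ∀ n j : ℕ, j < n → PosetFree P (levels n j k)} k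

/-- The up-set generated by `𝓕`. -/
def upSet {n : ℕ} (𝓕 : Finset (Finset (Fin n))) : Finset (Finset (Fin n)) :=
  Finset.univ.filter fun H => ∃ F ∈ 𝓕, F ⊆ H

/-- The two middle levels, for odd `n`. -/
def oddBase (n : ℕ) : Finset (Finset (Fin n)) :=
  Finset.univ.filter fun F => F.card = n / 2 ∨ F.card = n / 2 + 1

/-- For even `n`: the sets of size `n / 2 - 1` or `n / 2` that contain the first point of the ground
set, and the sets of size `n / 2` or `n / 2 + 1` that do not contain it. -/
def evenBase (n : ℕ) : Finset (Finset (Fin n)) :=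
  Finset.univ.filter fun F =>
    ((∃ i ∈ F, (i : ℕ) = 0) ∧ (F.card + 1 = n / 2 ∨ F.card = n / 2)) ∨
    ((¬ ∃ i ∈ F, (i : ℕ) = 0) ∧ (F.card = n / 2 ∨ F.card = n / 2 + 1))

/-! Lower bound. In the up-sets, disjoint members are nearly complementary: for odd `n` adjacent
sets lie in the two middle levels. Complementing the images of the vertices in `A` turns
disjointness into inclusion, so a copy of `G` would give an order-preserving map of the poset into
two consecutive levels. The map may identify a vertex of `A` with one of `B`;
`no_map_of_posetFree_levels` repairs this on a larger ground set and contradicts the freeness of two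
levels. For even `n`, one point is counted twice, which restores the odd case.

Upper bound. A family of more than `2 ^ (n - 1)` sets contains complementary pairs. If both `X` and
`Xᶜ` had many members below them, those members would span a complete bipartite graph containing
`G`. So, apart from very small sets and their complements, one set of each pair has boundedly many
members below it, and the LYM-type inequality `card_mul_le_of_few_below` bounds the number of such
sets by about one middle level. -/

/-! ### Maps of the poset into two consecutive levels -/

/-- If two consecutive levels never contain a copy of `P`, then `P` admits no injective
order-preserving map into two consecutive nonempty levels over any finite ground set. -/
theorem no_injective_map_of_posetFree_levels {V : Type*} (P : PartialOrder V)
    (h2 : ∀ n j : ℕ, j < n → PosetFree P (levels n j 2)) [Nonempty V]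
    {β : Type*} [Fintype β] (g : V → Finset β) (j : ℕ) (hinj : Function.Injective g)
    (hcard : ∀ v, (g v).card = j + 1 ∨ (g v).card = j + 2)
    (hsub : ∀ p q, P.lt p q → g p ⊆ g q) : False := by
  classical
  let e : β ↪ Fin (Fintype.card β) := (Fintype.equivFin β).toEmbedding
  let b : V → Finset (Fin (Fintype.card β)) := fun v => (g v).map e
  have hb : Function.Injective b := (Finset.map_injective e).comp hinj
  have hj : j < Fintype.card β := by
    have h1 := hcard (Classical.arbitrary V)
    have h3 := (g (Classical.arbitrary V)).card_le_univ
    omega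
  have : Finite V := Finite.of_injective b hb
  have : Fintype V := Fintype.ofFinite V
  refine h2 _ j hj (Finset.univ.image b) ?_ ?_
  · intro F hF
    obtain ⟨v, -, rfl⟩ := Finset.mem_image.1 hF
    have := hcard v
    simp only [levels, b, Finset.mem_filter, Finset.mem_univ, true_and, Finset.card_map]
    omega
  · refine ⟨(Equiv.ofInjective b hb).trans (Equiv.subtypeEquivRight (by simp)), ?_⟩
    intro p q hpq
    exact Finset.map_subset_map.2 (hsub p q hpq)

/-- An inclusion-preserving map into levels `k`, `k + 1` can be made injective after enlarging the
ground set: small upper sets receive a private new point, large lower sets lose one. -/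
theorem no_map_of_posetFree_levels {V : Type*} [Finite V] (G : SimpleGraph V) (A B : Set V)
    (hG : G.IsBipartiteWith A B) (hAB : A ∪ B = Set.univ)
    (h2 : ∀ n j : ℕ, j < n → PosetFree (bipartitePoset G A B hG) (levels n j 2)) [Nonempty V]
    {α : Type*} [Fintype α] (g : V → Finset α) (k : ℕ)
    (hcard : ∀ v, (g v).card = k ∨ (g v).card = k + 1)
    (hA : ∀ v ∈ A, ∀ w ∈ A, (g v).card = k + 1 → g v = g w → v = w)
    (hB : ∀ v ∈ B, ∀ w ∈ B, (g v).card = k → g v = g w → v = w)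
    (hsub : ∀ b a, a ∈ A → b ∈ B → G.Adj b a → g b ⊆ g a) : False := by
  classical
  have : Fintype V := Fintype.ofFinite V
  have hdis : ∀ v, v ∈ A → v ∉ B := fun v hv => Set.disjoint_left.1 hG.disjoint hv
  have hcov : ∀ v, v ∉ A → v ∈ B := fun v hv =>
    ((Set.ext_iff.1 hAB v).2 trivial).resolve_left hv
  -- After the modification `A` fills the upper level and `B` the lower one, so a vertex of `A`
  -- never collides with one of `B`. Inclusions survive because only sets of `A` gain points and
  -- only sets of `B` lose them.
  let up : V → Finset V := fun v => if v ∈ A ∧ (g v).card = k then {v} else ∅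
  let dn : V → Finset V := fun v =>
    if v ∈ B ∧ (g v).card = k + 1 then Finset.univ.erase v else Finset.univ
  have hN : 0 < Fintype.card V := Fintype.card_pos
  have hcA : ∀ v ∈ A, ((g v).disjSum ((up v).disjSum (dn v))).card
      = k + (Fintype.card V - 1) + 2 := by
    intro v hv
    rcases hcard v with h | h <;>
      simp [up, dn, hv, hdis v hv, h, Finset.card_disjSum] <;> omega
  have hcB : ∀ v ∈ B, ((g v).disjSum ((up v).disjSum (dn v))).card
      = k + (Fintype.card V - 1) + 1 := by
    intro v hv
    have hv' : v ∉ A := fun h => hdis v h hv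
    rcases hcard v with h | h <;>
      simp [up, dn, hv, hv', h, Finset.card_disjSum, Finset.card_erase_of_mem] <;> omega
  -- The block `dn` also lifts both levels above level `0`, which `levels` never includes; the
  -- subtraction is exact since `V` is nonempty.
  refine no_injective_map_of_posetFree_levels (bipartitePoset G A B hG) h2
    (fun v => (g v).disjSum ((up v).disjSum (dn v))) (k + (Fintype.card V - 1)) ?_ ?_ ?_
  · intro v w hvw
    have hc := congrArg Finset.card hvw
    obtain ⟨hg, hrest⟩ := Finset.disjSum_inj.1 hvw
    obtain ⟨hup, hdn⟩ := Finset.disjSum_inj.1 hrest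
    by_cases hv : v ∈ A <;> by_cases hw : w ∈ A
    · rcases hcard v with h | h
      · have h' := hg ▸ h
        simpa [up, hv, hw, h, h'] using hup
      · exact hA v hv w hw h hg
    · have := hcA v hv
      have := hcB w (hcov w hw)
      dsimp only at hc
      omega
    · have := hcA w hw
      have := hcB v (hcov v hv)
      dsimp only at hc
      omega
    · have hv := hcov v hv
      have hw := hcov w hw
      rcases hcard v with h | h
      · exact hB v hv w hw h hg
      · have h' := hg ▸ h
        have h1 : v ∉ dn v := by simp [dn, hv, h]
        rw [hdn] at h1
        simpa [dn, hw, h'] using h1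
  · intro v
    by_cases hv : v ∈ A
    · exact Or.inr (hcA v hv)
    · exact Or.inl (hcB v (hcov v hv))
  · intro p q hpq
    obtain ⟨hadj, hq⟩ := (bipartitePoset_lt_iff G A B hG p q).1 hpq
    have hp : p ∈ B := hG.mem_of_mem_adj hq hadj.symm
    have hp' : p ∉ A := fun h => hdis p h hp
    have hq' := hdis q hq
    refine Finset.disjSum_mono (hsub p q hq hp hadj) (Finset.disjSum_mono ?_ ?_)
    · simp [up, hp']
    · simp [dn, hq']

/-- The preceding lemma with all conditions required for non-isolated vertices only. -/
theorem no_map_of_posetFree_levels' {V : Type*} [Finite V] (G : SimpleGraph V) (A B : Set V)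
    (hG : G.IsBipartiteWith A B) (hAB : A ∪ B = Set.univ)
    (h2 : ∀ n j : ℕ, j < n → PosetFree (bipartitePoset G A B hG) (levels n j 2)) [Nonempty V]
    {α : Type*} [Fintype α] (g : V → Finset α) (k : ℕ) (hk : k + 1 ≤ Fintype.card α)
    (hcard : ∀ v w, G.Adj v w → (g v).card = k ∨ (g v).card = k + 1)
    (hA : ∀ v ∈ A, ∀ w ∈ A, g v = g w → v = w)
    (hB : ∀ v ∈ B, ∀ w ∈ B, g v = g w → v = w)
    (hsub : ∀ b a, a ∈ A → b ∈ B → G.Adj b a → g b ⊆ g a) : False := by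
  classical
  obtain ⟨X, -, hX⟩ := Finset.exists_subset_card_eq (s := (Finset.univ : Finset α)) (n := k)
    (by rw [Finset.card_univ]; omega)
  obtain ⟨Y, -, hY⟩ := Finset.exists_subset_card_eq (s := (Finset.univ : Finset α)) (n := k + 1)
    (by rw [Finset.card_univ]; omega)
  have hdis : ∀ v, v ∈ A → v ∉ B := fun v hv => Set.disjoint_left.1 hG.disjoint hv
  -- Isolated vertices get size `k` in `A` and `k + 1` in `B`: exactly the sizes at which the
  -- previous lemma tolerates collisions.
  refine no_map_of_posetFree_levels G A B hG hAB h2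
    (fun v => if ∃ w, G.Adj v w then g v else if v ∈ A then X else Y) k ?_ ?_ ?_ ?_
  · intro v
    by_cases h : ∃ w, G.Adj v w
    · obtain ⟨w, hw⟩ := h
      have : ∃ w, G.Adj v w := ⟨w, hw⟩
      simpa only [this, if_true] using hcard v w hw
    · by_cases hv : v ∈ A <;> simp [h, hv, hX, hY]
  · intro v hv w hw hc hvw
    by_cases h : ∃ u, G.Adj v u
    · by_cases h' : ∃ u, G.Adj w u
      · simp only [h, h', if_true] at hvw
        exact hA v hv w hw hvw
      · rw [hvw] at hc
        simp [h', hw, hX] at hc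
    · simp [h, hv, hX] at hc
  · intro v hv w hw hc hvw
    have hv' : v ∉ A := fun h => hdis v h hv
    have hw' : w ∉ A := fun h => hdis w h hw
    by_cases h : ∃ u, G.Adj v u
    · by_cases h' : ∃ u, G.Adj w u
      · simp only [h, h', if_true] at hvw
        exact hB v hv w hw hvw
      · rw [hvw] at hc
        simp [h', hw', hY] at hc
    · simp [h, hv', hY] at hc
  · intro b a ha hb hba
    have h1 : ∃ w, G.Adj b w := ⟨a, hba⟩
    have h3 : ∃ w, G.Adj a w := ⟨b, hba.symm⟩
    simpa only [h1, h3, if_true] using hsub b a ha hb hba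

/-! ### The extremal families are `G`-free -/

theorem mem_upSet_oddBase {n : ℕ} (H : Finset (Fin n)) : H ∈ upSet (oddBase n) ↔ n / 2 ≤ H.card := by
  simp only [upSet, oddBase, Finset.mem_filter, Finset.mem_univ, true_and]
  constructor
  · rintro ⟨F, hF, hFH⟩
    have := Finset.card_le_card hFH
    omega
  · intro h
    obtain ⟨F, hF, hc⟩ := Finset.exists_subset_card_eq h
    exact ⟨F, Or.inl hc, hF⟩

theorem mem_upSet_evenBase {n : ℕ} (hn2 : 2 ≤ n) (H : Finset (Fin n)) :
    H ∈ upSet (evenBase n) ↔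
      (⟨0, by omega⟩ ∈ H ∧ n / 2 ≤ H.card + 1) ∨ (⟨0, by omega⟩ ∉ H ∧ n / 2 ≤ H.card) := by
  have h0 : ∀ F : Finset (Fin n), (∃ i ∈ F, (i : ℕ) = 0) ↔ (⟨0, by omega⟩ : Fin n) ∈ F := by
    intro F
    constructor
    · rintro ⟨i, hi, hi0⟩
      rwa [show (⟨0, by omega⟩ : Fin n) = i from Fin.ext hi0.symm]
    · exact fun h => ⟨_, h, rfl⟩
  simp only [upSet, evenBase, Finset.mem_filter, Finset.mem_univ, true_and, h0]
  generalize (⟨0, by omega⟩ : Fin n) = z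
  constructor
  · rintro ⟨F, hF, hFH⟩
    have hc := Finset.card_le_card hFH
    by_cases hz : z ∈ H
    · left
      exact ⟨hz, by omega⟩
    · have : z ∉ F := fun h => hz (hFH h)
      simp only [this, false_and, not_false_eq_true, true_and, false_or] at hF
      right
      exact ⟨hz, by omega⟩
  · rintro (⟨hz, h⟩ | ⟨hz, h⟩)
    · by_cases h' : H.card + 1 = n / 2
      · exact ⟨H, Or.inl ⟨hz, Or.inl h'⟩, subset_rfl⟩
      · obtain ⟨F, hF1, hF2, hF3⟩ := Finset.exists_subsuperset_card_eq (n := n / 2)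
          (Finset.singleton_subset_iff.2 hz) (by rw [Finset.card_singleton]; omega) (by omega)
        exact ⟨F, Or.inl ⟨Finset.singleton_subset_iff.1 hF1, Or.inr hF3⟩, hF2⟩
    · obtain ⟨F, hF, hc⟩ := Finset.exists_subset_card_eq h
      exact ⟨F, Or.inr ⟨fun h => hz (hF h), Or.inl hc⟩, hF⟩

/-- For `n = 2 * k + 1`, two disjoint sets of size at least `k` both have size `k` or `k + 1`, and
so do their complements. -/
theorem inducesFree_upSet_oddBase {V : Type*} [Finite V] (G : SimpleGraph V) (A B : Set V)
    (hG : G.IsBipartiteWith A B) (hAB : A ∪ B = Set.univ)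
    (h2 : ∀ n j : ℕ, j < n → PosetFree (bipartitePoset G A B hG) (levels n j 2)) [Nonempty V]
    {n : ℕ} (hn : Odd n) : InducesFree G (upSet (oddBase n)) := by
  classical
  rintro ⟨f⟩
  have hdis : ∀ v, v ∈ A → v ∉ B := fun v hv => Set.disjoint_left.1 hG.disjoint hv
  have hmem : ∀ v, n / 2 ≤ (f v).1.card := fun v => (mem_upSet_oddBase _).1 (f v).2
  have hadj : ∀ v w, G.Adj v w → Disjoint (f v).1 (f w).1 := fun v w h => (f.toHom.map_adj h).2
  have hcov : ∀ v, v ∉ A → v ∈ B := fun v hv =>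
    ((Set.ext_iff.1 hAB v).2 trivial).resolve_left hv
  obtain ⟨k, rfl⟩ := hn
  refine no_map_of_posetFree_levels' G A B hG hAB h2
    (fun v => if v ∈ A then (f v).1ᶜ else (f v).1) k (by simp; omega) ?_ ?_ ?_ ?_
  · intro v w hvw
    have h1 := hmem v
    have h3 := hmem w
    have h4 := Finset.card_union_of_disjoint (hadj v w hvw)
    have h5 := ((f v).1 ∪ (f w).1).card_le_univ
    rw [Fintype.card_fin] at h5
    by_cases hv : v ∈ A <;> simp only [hv, if_true, if_false, Finset.card_compl, Fintype.card_fin] <;>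
      omega
  · intro v hv w hw h
    simp only [hv, hw, if_true, compl_inj_iff] at h
    exact f.injective (Subtype.ext h)
  · intro v hv w hw h
    have hv' : v ∉ A := fun h => hdis v h hv
    have hw' : w ∉ A := fun h => hdis w h hw
    simp only [hv', hw', if_false] at h
    exact f.injective (Subtype.ext h)
  · intro b a ha hb hba
    have hb' : b ∉ A := fun h => hdis b h hb
    simp only [ha, hb', if_true, if_false]
    exact Finset.subset_compl_iff_disjoint_right.2 (hadj b a hba)

/-- Give the first point weight 2. The total weight is then odd, every member has weight at least `n
/ 2`, and the argument for odd `n` applies to weights; `φ` realises the weight by a twin of the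
point `z`. -/
theorem inducesFree_upSet_evenBase {V : Type*} [Finite V] (G : SimpleGraph V) (A B : Set V)
    (hG : G.IsBipartiteWith A B) (hAB : A ∪ B = Set.univ)
    (h2 : ∀ n j : ℕ, j < n → PosetFree (bipartitePoset G A B hG) (levels n j 2)) [Nonempty V]
    {n : ℕ} (hn : Even n) (hn2 : 2 ≤ n) : InducesFree G (upSet (evenBase n)) := by
  classical
  rintro ⟨f⟩
  have hdis : ∀ v, v ∈ A → v ∉ B := fun v hv => Set.disjoint_left.1 hG.disjoint hv
  have hmem := fun v => (mem_upSet_evenBase hn2 _).1 (f v).2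
  have hadj : ∀ v w, G.Adj v w → Disjoint (f v).1 (f w).1 := fun v w h => (f.toHom.map_adj h).2
  generalize (⟨0, by omega⟩ : Fin n) = z at hmem
  obtain ⟨m, rfl⟩ := hn
  let φ : Finset (Fin (m + m)) → Finset (Fin (m + m) ⊕ Unit) := fun F =>
    F.disjSum (if z ∈ F then {()} else ∅)
  have hφ : Function.Injective φ := fun F F' h => (Finset.disjSum_inj.1 h).1
  refine no_map_of_posetFree_levels' G A B hG hAB h2
    (fun v => φ (if v ∈ A then (f v).1ᶜ else (f v).1)) m (by simp) ?_ ?_ ?_ ?_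
  · intro v w hvw
    have h1 := hmem v
    have h3 := hmem w
    have h4 := Finset.card_union_of_disjoint (hadj v w hvw)
    have h5 := ((f v).1 ∪ (f w).1).card_le_univ
    have h6 : z ∈ (f v).1 → z ∉ (f w).1 := fun h => Finset.disjoint_left.1 (hadj v w hvw) h
    -- Two members avoiding `z` have at least `m` elements each, too many to be disjoint: every edge
    -- has `z` in one of its ends.
    have h7 : z ∉ (f v).1 → z ∉ (f w).1 → ((f v).1 ∪ (f w).1).card + 1 ≤ m + m := by
      intro h h'
      have h8 : ((f v).1 ∪ (f w).1).card < Fintype.card (Fin (m + m)) :=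
        Finset.card_lt_univ_of_notMem (x := z) (by simp [h, h'])
      rw [Fintype.card_fin] at h8
      exact h8
    rw [Fintype.card_fin] at h5
    by_cases hv : v ∈ A <;> by_cases hz : z ∈ (f v).1 <;> by_cases hz' : z ∈ (f w).1 <;>
      simp only [φ, hv, hz, hz', if_true, if_false, Finset.card_compl, Fintype.card_fin,
        Finset.card_disjSum, Finset.mem_compl, not_true_eq_false, not_false_eq_true,
        Finset.card_singleton, Finset.card_empty, true_and, false_and, or_false, false_or,
        true_imp_iff, false_imp_iff] at h1 h3 h6 h7 ⊢ <;>
      omega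
  · intro v hv w hw h
    have h := hφ h
    simp only [hv, hw, if_true, compl_inj_iff] at h
    exact f.injective (Subtype.ext h)
  · intro v hv w hw h
    have hv' : v ∉ A := fun h => hdis v h hv
    have hw' : w ∉ A := fun h => hdis w h hw
    have h := hφ h
    simp only [hv', hw', if_false] at h
    exact f.injective (Subtype.ext h)
  · intro b a ha hb hba
    have hb' : b ∉ A := fun h => hdis b h hb
    simp only [ha, hb', if_true, if_false]
    have hs : (f b).1 ⊆ (f a).1ᶜ := Finset.subset_compl_iff_disjoint_right.2 (hadj b a hba)
    refine Finset.disjSum_mono hs ?_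
    by_cases hz : z ∈ (f b).1
    · rw [if_pos hz, if_pos (hs hz)]
    · rw [if_neg hz]
      exact Finset.empty_subset _

/-! ### A LYM-type inequality -/

theorem le_choose_of_pos_of_lt {a b : ℕ} (ha : 0 < a) (hab : a < b) : b ≤ b.choose a := by
  obtain ⟨c, rfl⟩ := Nat.exists_eq_succ_of_ne_zero ha.ne'
  obtain ⟨d, rfl⟩ := Nat.exists_eq_add_of_lt hab
  clear ha hab
  induction c with
  | zero => simp
  | succ c ih =>
    have h := Nat.choose_succ_succ (c.succ + d + 1) (c + 1)
    have hpos : 0 < (c.succ + d + 1).choose (c + 1).succ := Nat.choose_pos (by omega)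
    rw [show (c + 1).succ + d + 1 = (c.succ + d + 1).succ by omega, h]
    simp only [Nat.succ_eq_add_one] at *
    omega

/-- An upper bound for the number of numberings in which both `A` and the larger set `B` are prefixes. -/
theorem card_mul_card_prefixed_inter_le {α : Type*} [Fintype α] [DecidableEq α] {A B : Finset α}
    (hA : A.Nonempty) (hAB : A ⊂ B) :
    B.card * (Numbering.prefixed A ∩ Numbering.prefixed B).card ≤ (Numbering.prefixed B).card := by
  let A' : Finset B := A.subtype (· ∈ B)
  have hA' : A'.card = A.card := by
    rw [Finset.card_subtype, Finset.filter_true_of_mem fun x hx => hAB.1 hx]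
  have hlt : A.card < B.card := Finset.card_lt_card hAB
  -- Such a numbering splits into a numbering of `B` starting with `A` and one of `Bᶜ`. Among the
  -- numberings starting with `B` their share is at most `1 / (B.card.choose A.card)`, hence at most
  -- `1 / B.card`. The value outside `prefixed B` is a dummy.
  have h1 : (Numbering.prefixed A ∩ Numbering.prefixed B).card ≤
      (Numbering.prefixed A' ×ˢ (Finset.univ : Finset (Numbering ↑(Bᶜ)))).card := by
    refine Finset.card_le_card_of_injOn
      (fun f => if h : f ∈ Numbering.prefixed B then Numbering.prefixedEquiv B ⟨f, h⟩ else
        (Fintype.equivFin _, Fintype.equivFin _)) ?_ ?_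
    · intro f hf
      obtain ⟨hfA, hfB⟩ := Finset.mem_inter.1 hf
      simp only [hfB, dif_pos, Finset.coe_product, Set.mem_prod, Finset.mem_coe,
        Numbering.mem_prefixed, Finset.mem_univ, and_true]
      intro x
      have := Numbering.mem_prefixed.1 hfA x.1
      rw [hA', Finset.mem_subtype, this]
      rfl
    · intro f hf f' hf' h
      have hfB := (Finset.mem_inter.1 hf).2
      have hfB' := (Finset.mem_inter.1 hf').2
      simp only [hfB, hfB', dif_pos] at h
      simpa using (Numbering.prefixedEquiv B).injective h
  rw [Finset.card_product, Numbering.card_prefixed, Finset.card_univ, Fintype.card_numbering,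
    hA', Fintype.card_coe, Fintype.card_coe, Finset.card_compl] at h1
  rw [Numbering.card_prefixed]
  refine (Nat.mul_le_mul_left _ h1).trans ?_
  rw [← mul_assoc]
  refine Nat.mul_le_mul_right _ ?_
  rw [← Nat.choose_mul_factorial_mul_factorial hlt.le, mul_assoc]
  refine Nat.mul_le_mul_right _ ?_
  exact le_choose_of_pos_of_lt hA.card_pos hlt

/-- A LYM-type inequality: if every member of `H` has at least `r` elements and contains at most `s`
other members, then `H` is not much larger than an antichain. -/
theorem card_mul_le_of_few_below {α : Type*} [Fintype α] [DecidableEq α] (H : Finset (Finset α))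
    {r s : ℕ} (hr : 0 < r) (hcard : ∀ B ∈ H, r ≤ B.card)
    (hs : ∀ B ∈ H, (H.filter (· ⊂ B)).card ≤ s) :
    H.card * (r - s) ≤ r * (Fintype.card α).choose (Fintype.card α / 2) := by
  classical
  let N := Fintype.card α
  let p : Finset α → Finset (Numbering α) := Numbering.prefixed
  let q : Finset α → Finset (Numbering α) := fun B => p B \ (H.filter (· ⊂ B)).biUnion p
  -- `q B` collects the numberings whose smallest prefix in `H` is `B`.
  have hdisj : (H : Set (Finset α)).PairwiseDisjoint q := by
    have key : ∀ B ∈ H, ∀ C ∈ H, B ≠ C → B.card ≤ C.card → Disjoint (q B) (q C) := by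
      intro B hB C _ hne hle
      refine Finset.disjoint_left.2 fun f hfB hfC => ?_
      obtain ⟨h1, -⟩ := Finset.mem_sdiff.1 hfB
      obtain ⟨h3, h4⟩ := Finset.mem_sdiff.1 hfC
      have hsub := (Numbering.mem_prefixed.1 h1).subset_of_card_le_card
        (Numbering.mem_prefixed.1 h3) hle
      exact h4 (Finset.mem_biUnion.2
        ⟨B, Finset.mem_filter.2 ⟨hB, hsub.ssubset_of_ne hne⟩, h1⟩)
    intro B hB C hC hne
    rcases le_total B.card C.card with h | h
    · exact key B hB C hC hne h
    · exact (key C hC B hB hne.symm h).symm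
  have hsum : ∑ B ∈ H, (q B).card ≤ N.factorial := by
    rw [← Finset.card_biUnion hdisj]
    exact (Finset.card_le_univ _).trans_eq Fintype.card_numbering
  -- Each of the at most `s` members below `B` spoils at most a `1 / r` share of `p B`.
  have hq : ∀ B ∈ H, (r - s) * (p B).card ≤ r * (q B).card := by
    intro B hB
    have hU : r * (p B ∩ (H.filter (· ⊂ B)).biUnion p).card ≤ s * (p B).card := by
      rw [Finset.inter_biUnion]
      calc r * ((H.filter (· ⊂ B)).biUnion fun A => p B ∩ p A).card
          ≤ r * ∑ A ∈ H.filter (· ⊂ B), (p B ∩ p A).card :=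
            Nat.mul_le_mul_left _ Finset.card_biUnion_le
        _ = ∑ A ∈ H.filter (· ⊂ B), r * (p A ∩ p B).card := by
            rw [Finset.mul_sum]
            exact Finset.sum_congr rfl fun A _ => by rw [Finset.inter_comm]
        _ ≤ ∑ A ∈ H.filter (· ⊂ B), (p B).card := by
            refine Finset.sum_le_sum fun A hA => ?_
            obtain ⟨hAH, hAB⟩ := Finset.mem_filter.1 hA
            exact (Nat.mul_le_mul_right _ (hcard B hB)).trans (card_mul_card_prefixed_inter_le
              (Finset.card_pos.1 (hr.trans_le (hcard A hAH))) hAB)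
        _ ≤ s * (p B).card := by
            rw [Finset.sum_const, smul_eq_mul]
            exact Nat.mul_le_mul_right _ (hs B hB)
    have hsplit := Finset.card_sdiff_add_card_inter (p B) ((H.filter (· ⊂ B)).biUnion p)
    have h5 : r * (p B).card = r * (q B).card +
        r * (p B ∩ (H.filter (· ⊂ B)).biUnion p).card := by rw [← mul_add, hsplit]
    rw [Nat.sub_mul]
    omega
  have hp : ∀ B : Finset α, N.factorial ≤ (p B).card * N.choose (N / 2) := by
    intro B
    calc N.factorial = (p B).card * N.choose B.card := by
          rw [Numbering.card_prefixed, ← Nat.choose_mul_factorial_mul_factorial B.card_le_univ]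
          ring
      _ ≤ _ := Nat.mul_le_mul_left _ (Nat.choose_le_middle _ _)
  have hfin : H.card * (r - s) * N.factorial ≤ r * N.choose (N / 2) * N.factorial := by
    calc H.card * (r - s) * N.factorial = ∑ B ∈ H, (r - s) * N.factorial := by
          rw [Finset.sum_const, smul_eq_mul, mul_assoc]
      _ ≤ ∑ B ∈ H, r * (q B).card * N.choose (N / 2) := by
          refine Finset.sum_le_sum fun B hB => ?_
          calc (r - s) * N.factorial ≤ (r - s) * ((p B).card * N.choose (N / 2)) :=
                Nat.mul_le_mul_left _ (hp B)
            _ = (r - s) * (p B).card * N.choose (N / 2) := by ring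
            _ ≤ _ := Nat.mul_le_mul_right _ (hq B hB)
      _ = r * N.choose (N / 2) * ∑ B ∈ H, (q B).card := by
          rw [Finset.mul_sum]
          exact Finset.sum_congr rfl fun B _ => by ring
      _ ≤ _ := Nat.mul_le_mul_left _ hsum
  exact Nat.le_of_mul_le_mul_right hfin N.factorial_pos

/-! ### Upper bound for `G`-free families -/

/-- In a `G`-free family with bipartite `G`, no set and its complement both contain many members. -/
theorem card_below_lt_or_card_below_compl_lt {V : Type*} [Fintype V] (G : SimpleGraph V) (A B : Set V)
    (hG : G.IsBipartiteWith A B) {n : ℕ} (𝓕 : Finset (Finset (Fin n)))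
    (hfree : InducesFree G 𝓕) (X : Finset (Fin n)) :
    (𝓕.filter (· ⊂ X)).card < 2 * Fintype.card V ∨
      (𝓕.filter (· ⊂ Xᶜ)).card < 2 * Fintype.card V := by
  classical
  by_contra! h
  obtain ⟨h1, h2⟩ := h
  have hdis : ∀ v, v ∈ A → v ∉ B := fun v hv => Set.disjoint_left.1 hG.disjoint hv
  obtain ⟨φ⟩ : Nonempty (V ↪ 𝓕.filter (· ⊂ X)) :=
    Function.Embedding.nonempty_of_card_le (by rw [Fintype.card_coe]; omega)
  -- The empty set may lie below both `X` and `Xᶜ`, so the images of `φ` are removed before `ψ` is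
  -- chosen; this is why `2 * Fintype.card V` members are needed.
  let S : Finset (Finset (Fin n)) := Finset.univ.image fun v => (φ v).1
  have hS : S.card ≤ Fintype.card V := Finset.card_image_le
  obtain ⟨ψ⟩ : Nonempty (V ↪ ((𝓕.filter (· ⊂ Xᶜ)) \ S : Finset (Finset (Fin n)))) := by
    refine Function.Embedding.nonempty_of_card_le ?_
    have := Finset.le_card_sdiff S (𝓕.filter (· ⊂ Xᶜ))
    rw [Fintype.card_coe]
    omega
  have hφ : ∀ v, (φ v).1 ∈ 𝓕 ∧ (φ v).1 ⊂ X := fun v => Finset.mem_filter.1 (φ v).2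
  have hψ : ∀ v, ((ψ v).1 ∈ 𝓕 ∧ (ψ v).1 ⊂ Xᶜ) ∧ (ψ v).1 ∉ S := fun v => by
    simpa only [Finset.mem_sdiff, Finset.mem_filter] using (ψ v).2
  have hne : ∀ v w, (ψ v).1 ≠ (φ w).1 := fun v w h =>
    (hψ v).2 (Finset.mem_image.2 ⟨w, Finset.mem_univ _, h.symm⟩)
  have hd : ∀ v w, Disjoint (ψ v).1 (φ w).1 := fun v w =>
    Finset.disjoint_of_subset_left (hψ v).1.2.1
      (Finset.disjoint_of_subset_right (hφ w).2.1 disjoint_compl_left)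
  let f : V → (𝓕 : Set (Finset (Fin n))) := fun v =>
    if v ∈ A then ⟨(ψ v).1, (hψ v).1.1⟩ else ⟨(φ v).1, (hφ v).1⟩
  refine hfree ⟨⟨⟨f, ?_⟩, ?_⟩⟩
  · intro v w hvw
    rcases hG.mem_of_adj hvw with ⟨hv, hw⟩ | ⟨hv, hw⟩
    · have hw' : w ∉ A := fun h => hdis w h hw
      simp only [f, hv, hw', if_true, if_false]
      exact ⟨hne v w, hd v w⟩
    · have hv' : v ∉ A := fun h => hdis v h hv
      simp only [f, hw, hv', if_true, if_false]
      exact ⟨(hne w v).symm, (hd w v).symm⟩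
  · intro v w hvw
    have hvw : (f v).1 = (f w).1 := congrArg Subtype.val hvw
    by_cases hv : v ∈ A <;> by_cases hw : w ∈ A <;>
      simp only [f, hv, hw, if_true, if_false] at hvw
    · exact ψ.injective (Subtype.ext hvw)
    · exact absurd hvw (hne v w)
    · exact absurd hvw.symm (hne w v)
    · exact φ.injective (Subtype.ext hvw)

theorem card_filter_card_lt (n r : ℕ) :
    ((Finset.univ : Finset (Finset (Fin n))).filter fun F => F.card < r).card =
      ∑ i ∈ Finset.range r, n.choose i := by
  classical
  rw [Finset.card_eq_sum_card_fiberwise (f := Finset.card) (t := Finset.range r)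
    (fun F hF => by simpa using hF)]
  refine Finset.sum_congr rfl fun i hi => ?_
  have hi := Finset.mem_range.1 hi
  rw [Finset.filter_filter]
  conv_rhs => rw [← Fintype.card_fin n, ← Finset.card_univ, ← Finset.card_powersetCard]
  congr 1
  ext F
  simp only [Finset.mem_filter, Finset.mem_univ, true_and, Finset.mem_powersetCard,
    Finset.subset_univ]
  omega

/-- The number of sets in a `G`-free family, for bipartite `G`: the error term consists of a
multiple of the middle binomial coefficient and of the sets with fewer than `r` elements. -/
theorem card_le_of_inducesFree {V : Type*} [Fintype V] (G : SimpleGraph V) (A B : Set V)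
    (hG : G.IsBipartiteWith A B) {n : ℕ} (hn : 1 ≤ n)
    (𝓕 : Finset (Finset (Fin n)))
    (hfree : InducesFree G 𝓕) {r : ℕ} (hr : 0 < r) :
    ∃ h : ℕ, h * (r - 2 * Fintype.card V) ≤ r * n.choose (n / 2) ∧
      𝓕.card ≤ 2 ^ (n - 1) + ∑ i ∈ Finset.range r, n.choose i + h := by
  classical
  have hmono : ∀ 𝓖 ⊆ 𝓕, InducesFree G 𝓖 := by
    rintro 𝓖 hsub ⟨f⟩
    exact hfree ⟨((kneserCube n).induceHomOfLE (Finset.coe_subset.2 hsub)).toCopy.comp f⟩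
  have hci : Function.Injective (compl : Finset (Fin n) → Finset (Fin n)) := compl_injective
  have hmem : ∀ (𝓖 : Finset (Finset (Fin n))) F, F ∈ 𝓖.image compl ↔ Fᶜ ∈ 𝓖 := by
    intro 𝓖 F
    constructor
    · intro h
      obtain ⟨F', h1, rfl⟩ := Finset.mem_image.1 h
      rwa [compl_compl]
    · exact fun h => Finset.mem_image.2 ⟨_, h, compl_compl F⟩
  let 𝓓 := 𝓕 ∩ 𝓕.image compl
  let 𝓜 := 𝓓.filter fun F => r ≤ F.card ∧ r ≤ Fᶜ.card
  let 𝓢 := (Finset.univ : Finset (Finset (Fin n))).filter fun F => F.card < r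
  let 𝓗 := 𝓜.filter fun X => (𝓜.filter (· ⊂ X)).card < 2 * Fintype.card V
  have hM : ∀ F, F ∈ 𝓜 ↔ (F ∈ 𝓕 ∧ Fᶜ ∈ 𝓕) ∧ r ≤ F.card ∧ r ≤ Fᶜ.card := by
    intro F
    simp only [𝓜, 𝓓, Finset.mem_filter, Finset.mem_inter, hmem]
  have hMc : ∀ F ∈ 𝓜, Fᶜ ∈ 𝓜 := by
    intro F hF
    rw [hM] at hF ⊢
    rw [compl_compl]
    tauto
  have hMfree : InducesFree G 𝓜 := hmono _ fun F hF => ((hM F).1 hF).1.1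
  have h1 : 𝓜.card ≤ 2 * 𝓗.card := by
    have hsub : 𝓜 ⊆ 𝓗 ∪ 𝓗.image compl := by
      intro X hX
      rw [Finset.mem_union, hmem]
      rcases card_below_lt_or_card_below_compl_lt G A B hG 𝓜 hMfree X with h | h
      · exact Or.inl (Finset.mem_filter.2 ⟨hX, h⟩)
      · exact Or.inr (Finset.mem_filter.2 ⟨hMc X hX, h⟩)
    have := (Finset.card_le_card hsub).trans (Finset.card_union_le _ _)
    rw [Finset.card_image_of_injective _ hci] at this
    omega
  have h2 : 𝓓.card ≤ 𝓜.card + 2 * 𝓢.card := by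
    have hsub : 𝓓 ⊆ 𝓜 ∪ (𝓢 ∪ 𝓢.image compl) := by
      intro F hF
      simp only [𝓜, 𝓢, Finset.mem_union, hmem, Finset.mem_filter, Finset.mem_univ, true_and]
      have : F ∈ 𝓓 := hF
      by_cases h3 : F.card < r
      · tauto
      · by_cases h4 : Fᶜ.card < r
        · tauto
        · exact Or.inl ⟨hF, not_lt.1 h3, not_lt.1 h4⟩
    have h3 := (Finset.card_le_card hsub).trans (Finset.card_union_le _ _)
    have h4 := Finset.card_union_le 𝓢 (𝓢.image compl)
    rw [Finset.card_image_of_injective _ hci] at h4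
    omega
  -- Inclusion–exclusion for the family and its family of complements.
  have h3 : 2 * 𝓕.card ≤ 2 ^ n + 𝓓.card := by
    have h4 := Finset.card_union_add_card_inter 𝓕 (𝓕.image compl)
    rw [Finset.card_image_of_injective _ hci] at h4
    have h5 := (𝓕 ∪ 𝓕.image compl).card_le_univ
    rw [Fintype.card_finset, Fintype.card_fin] at h5
    change _ + 𝓓.card = _ at h4
    omega
  refine ⟨𝓗.card, ?_, ?_⟩
  · have := card_mul_le_of_few_below 𝓗 (r := r) (s := 2 * Fintype.card V) hr
      (fun X hX => ((hM X).1 (Finset.mem_filter.1 hX).1).2.1) (fun X hX => ?_)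
    · rwa [Fintype.card_fin] at this
    · exact (Finset.card_le_card (Finset.filter_subset_filter _ (Finset.filter_subset _ _))).trans
        (Finset.mem_filter.1 hX).2.le
  · have h4 : 𝓢.card = _ := card_filter_card_lt n r
    rw [← h4]
    have h5 : 2 ^ n = 2 * 2 ^ (n - 1) := by
      rw [← pow_succ', Nat.sub_add_cancel hn]
    omega

/-! ### Sizes of the extremal families -/

theorem card_upSet_oddBase {n : ℕ} (hn : Odd n) :
    (upSet (oddBase n)).card = 2 ^ (n - 1) + n.choose (n / 2) := by
  classical
  have h1 : upSet (oddBase n) = Finset.univ.filter fun H => ¬ H.card < n / 2 := by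
    ext H
    rw [mem_upSet_oddBase, Finset.mem_filter, not_lt]
    exact ⟨fun h => ⟨Finset.mem_univ _, h⟩, fun h => h.2⟩
  have h2 := Finset.card_filter_add_card_filter_not
    (s := (Finset.univ : Finset (Finset (Fin n)))) (fun H => H.card < n / 2)
  rw [← h1, card_filter_card_lt, Finset.card_univ, Fintype.card_finset, Fintype.card_fin] at h2
  obtain ⟨k, rfl⟩ := hn
  rw [show (2 * k + 1) / 2 = k by omega] at *
  have h3 := Nat.sum_range_choose_halfway k
  rw [Finset.sum_range_succ] at h3
  rw [Nat.add_sub_cancel]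
  rw [pow_succ, pow_mul] at h2
  rw [pow_mul]
  norm_num at *
  omega

theorem two_mul_sum_range_choose_add_choose (m : ℕ) :
    2 * ∑ i ∈ Finset.range m, (2 * m).choose i + (2 * m).choose m = 2 ^ (2 * m) := by
  have h := Nat.sum_range_choose (2 * m)
  rw [show 2 * m + 1 = m + 1 + m by ring, Finset.sum_range_add, Finset.sum_range_succ] at h
  have h1 : ∑ x ∈ Finset.range m, (2 * m).choose (m + 1 + x) =
      ∑ x ∈ Finset.range m, (2 * m).choose x := by
    rw [← Finset.sum_range_reflect]
    refine Finset.sum_congr rfl fun i hi => ?_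
    have := Finset.mem_range.1 hi
    rw [← Nat.choose_symm_of_eq_add]
    omega
  omega

/-- Sets of size at least `m` number `2 ^ (2 * m - 1)` plus half the middle coefficient. That half
equals the number of sets of size `m - 1` avoiding `z`, so adding those containing `z` completes
level `m - 1` numerically. -/
theorem card_upSet_evenBase {m : ℕ} (hm : 1 ≤ m) :
    (upSet (evenBase (2 * m))).card = 2 ^ (2 * m - 1) + (2 * m).choose (m - 1) := by
  classical
  have hmem := mem_upSet_evenBase (n := 2 * m) (by omega)
  generalize (⟨0, by omega⟩ : Fin (2 * m)) = z at hmem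
  rw [show 2 * m / 2 = m by omega] at hmem
  let 𝓒 := (Finset.univ : Finset (Fin (2 * m))).powersetCard (m - 1)
  have h1 : upSet (evenBase (2 * m)) =
      (Finset.univ.filter fun H => ¬ H.card < m) ∪ 𝓒.filter fun H => ¬ z ∉ H := by
    ext H
    simp only [hmem, 𝓒, Finset.mem_union, Finset.mem_filter, Finset.mem_univ, true_and, not_lt,
      Finset.mem_powersetCard, Finset.subset_univ, not_not]
    by_cases hz : z ∈ H <;> simp [hz] <;> omega
  have hdisj : Disjoint (Finset.univ.filter fun H : Finset (Fin (2 * m)) => ¬ H.card < m)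
      (𝓒.filter fun H => ¬ z ∉ H) := by
    refine Finset.disjoint_left.2 fun H hH hH' => ?_
    have h := (Finset.mem_filter.1 hH).2
    have h' := (Finset.mem_powersetCard.1 (Finset.mem_filter.1 hH').1).2
    omega
  have h2 := Finset.card_filter_add_card_filter_not
    (s := (Finset.univ : Finset (Finset (Fin (2 * m))))) (fun H => H.card < m)
  have h3 := Finset.card_filter_add_card_filter_not (s := 𝓒) (fun H => z ∉ H)
  have h4 : (𝓒.filter fun H => z ∉ H) = (Finset.univ.erase z).powersetCard (m - 1) := by
    ext H
    simp only [𝓒, Finset.mem_filter, Finset.mem_powersetCard, Finset.subset_univ, true_and,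
      Finset.subset_erase]
    tauto
  rw [h4, Finset.card_powersetCard, Finset.card_powersetCard,
    Finset.card_erase_of_mem (Finset.mem_univ _), Finset.card_univ, Fintype.card_fin] at h3
  rw [card_filter_card_lt, Finset.card_univ, Fintype.card_finset, Fintype.card_fin] at h2
  rw [h1, Finset.card_union_of_disjoint hdisj]
  have h5 := two_mul_sum_range_choose_add_choose m
  obtain ⟨k, rfl⟩ := Nat.exists_eq_add_of_le' hm
  have h6 : (2 * (k + 1)).choose (k + 1) = 2 * (2 * k + 1).choose k := by
    rw [show 2 * (k + 1) = (2 * k + 1) + 1 by ring, Nat.choose_succ_succ,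
      Nat.choose_symm_half]
    ring
  have h7 : 2 ^ (2 * (k + 1)) = 2 * 2 ^ (2 * k + 1) := by ring
  rw [show 2 * (k + 1) - 1 = 2 * k + 1 by omega, Nat.add_sub_cancel] at *
  omega

/-- The relative error in the size of the extremal families. -/
noncomputable def baseError (n : ℕ) : ℝ := if Even n then -2 / (n + 2) else 0

theorem tendsto_baseError : Tendsto baseError atTop (𝓝 0) := by
  have h : Tendsto (fun n : ℕ => (-2 : ℝ) / ((n : ℝ) + 2)) atTop (𝓝 0) :=
    tendsto_const_nhds.div_atTop (tendsto_atTop_add_const_right _ _ tendsto_natCast_atTop_atTop)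
  refine squeeze_zero_norm (fun n => ?_) (tendsto_zero_iff_norm_tendsto_zero.1 h)
  unfold baseError
  split_ifs
  · exact le_rfl
  · rw [norm_zero]
    exact norm_nonneg _

theorem card_upSet_oddBase_eq {n : ℕ} (hn : Odd n) :
    ((upSet (oddBase n)).card : ℝ) =
      2 ^ (n - 1) + (1 + baseError n) * (n.choose (n / 2) : ℝ) := by
  rw [card_upSet_oddBase hn, baseError, if_neg (Nat.not_even_iff_odd.2 hn)]
  push_cast
  ring

theorem card_upSet_evenBase_eq {n : ℕ} (hn : Even n) (hn2 : 2 ≤ n) :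
    ((upSet (evenBase n)).card : ℝ) =
      2 ^ (n - 1) + (1 + baseError n) * (n.choose (n / 2) : ℝ) := by
  rw [baseError, if_pos hn]
  obtain ⟨m, rfl⟩ := hn.two_dvd
  rw [card_upSet_evenBase (by omega), show 2 * m / 2 = m by omega]
  obtain ⟨k, rfl⟩ := Nat.exists_eq_add_of_le' (show 1 ≤ m by omega)
  rw [Nat.add_sub_cancel]
  have h := Nat.choose_succ_right_eq (2 * (k + 1)) k
  rw [show 2 * (k + 1) - k = k + 2 by omega] at h
  have h' : ((2 * (k + 1)).choose (k + 1) : ℝ) * (k + 1) = (2 * (k + 1)).choose k * (k + 2) := by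
    exact_mod_cast h
  push_cast
  have hk : (2 * ((k : ℝ) + 1) + 2) ≠ 0 := by positivity
  field_simp
  linear_combination -h'

/-! ### Asymptotics and the main theorem -/

/-- The middle coefficient is at least the average `2 ^ n / (n + 1)`, while the numerator grows
polynomially. -/
theorem tendsto_choose_div_choose_middle (i : ℕ) :
    Tendsto (fun n : ℕ => (n.choose i : ℝ) / n.choose (n / 2)) atTop (𝓝 0) := by
  have h1 := (tendsto_pow_const_div_const_pow_of_one_lt (i + 1) (one_lt_two (α := ℝ))).add
    (tendsto_pow_const_div_const_pow_of_one_lt i (one_lt_two (α := ℝ)))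
  rw [add_zero] at h1
  refine squeeze_zero (fun n => by positivity) (fun n => ?_) h1
  have h2 : (2 : ℝ) ^ n ≤ (n + 1) * n.choose (n / 2) := by
    have h : 2 ^ n ≤ (n + 1) * n.choose (n / 2) := by
      rw [← Nat.sum_range_choose]
      refine (Finset.sum_le_card_nsmul _ _ _ fun j _ => Nat.choose_le_middle j n).trans_eq ?_
      rw [Finset.card_range, smul_eq_mul]
    exact_mod_cast h
  have h3 : (n.choose i : ℝ) ≤ (n : ℝ) ^ i := by exact_mod_cast Nat.choose_le_pow n i
  have hC : (0 : ℝ) < n.choose (n / 2) := by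
    exact_mod_cast Nat.choose_pos (Nat.div_le_self n 2)
  rw [← add_div, div_le_div_iff₀ hC (by positivity)]
  calc (n.choose i : ℝ) * 2 ^ n ≤ (n : ℝ) ^ i * ((n + 1) * n.choose (n / 2)) := by gcongr
    _ = _ := by ring

/-- The upper bound on `vex`. -/
theorem eventually_vex_le {V : Type*} [Finite V] [Nonempty V] (G : SimpleGraph V) (A B : Set V)
    (hG : G.IsBipartiteWith A B) {η : ℝ} (hη : 0 < η) :
    ∀ᶠ n : ℕ in atTop,
      (vex n G : ℝ) < 2 ^ (n - 1) + (1 + η) * (n.choose (n / 2) : ℝ) := by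
  have : Fintype V := Fintype.ofFinite V
  set s := 2 * Fintype.card V with hs
  -- With `r = s + k` the LYM factor `r / (r - s) = 1 + s / k` is below `1 + η / 2`; the other `η /
  -- 2` absorbs the sets with fewer than `r` elements.
  obtain ⟨k, hk⟩ := exists_nat_gt ((s : ℝ) / (η / 2))
  have hs0 : (0 : ℝ) ≤ (s : ℝ) / (η / 2) := by positivity
  have hk0 : (0 : ℝ) < k := hs0.trans_lt hk
  have hk1 : 0 < k := by exact_mod_cast hk0
  have hsk : (s : ℝ) < k * (η / 2) := (div_lt_iff₀ (by positivity)).1 hk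
  have hT : Tendsto (fun n : ℕ => ∑ i ∈ Finset.range (s + k),
      (n.choose i : ℝ) / n.choose (n / 2)) atTop (𝓝 0) := by
    simpa using tendsto_finsetSum (Finset.range (s + k))
      fun i _ => tendsto_choose_div_choose_middle i
  filter_upwards [hT.eventually_lt_const (half_pos hη), eventually_ge_atTop 1] with n hTn hn
  have hC : (0 : ℝ) < n.choose (n / 2) := by
    exact_mod_cast Nat.choose_pos (Nat.div_le_self n 2)
  rw [← Finset.sum_div, div_lt_iff₀ hC] at hTn
  obtain ⟨𝓕, hfree, hcard⟩ := (isGreatest_vex n G).1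
  obtain ⟨h, h1, h2⟩ := card_le_of_inducesFree G A B hG hn 𝓕 hfree (r := s + k) (by omega)
  rw [← hs, Nat.add_sub_cancel_left] at h1
  rw [hcard] at h2
  have h1' : (h : ℝ) * k ≤ (s + k) * n.choose (n / 2) := by exact_mod_cast h1
  have h2' : (vex n G : ℝ) ≤ 2 ^ (n - 1) + ∑ i ∈ Finset.range (s + k), (n.choose i : ℝ) + h := by
    exact_mod_cast h2
  have h3 : (h : ℝ) ≤ (1 + η / 2) * n.choose (n / 2) := by
    refine le_of_mul_le_mul_right ?_ hk0
    calc (h : ℝ) * k ≤ (s + k) * n.choose (n / 2) := h1'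
      _ ≤ (k * (η / 2) + k) * n.choose (n / 2) := by gcongr
      _ = _ := by ring
  linarith

theorem mainTheorem3 {V : Type*} [Finite V] (G : SimpleGraph V) (A B : Set V)
    (hG : G.IsBipartiteWith A B) (hAB : A ∪ B = Set.univ)
    (he : IsLevelNumber (bipartitePoset G A B hG) 2) :
    (∃ ε : ℕ → ℝ, Tendsto ε atTop (𝓝 0) ∧
      ∀ n : ℕ, 1 ≤ n →
        (vex n G : ℝ) = 2 ^ (n - 1) + (1 + ε n) * (n.choose (n / 2) : ℝ)) ∧
    (∃ δ : ℕ → ℝ, Tendsto δ atTop (𝓝 0) ∧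
      (∀ n : ℕ, Odd n →
        InducesFree G (upSet (oddBase n)) ∧
        ((upSet (oddBase n)).card : ℝ) =
          2 ^ (n - 1) + (1 + δ n) * (n.choose (n / 2) : ℝ)) ∧
      (∀ n : ℕ, Even n → 2 ≤ n →
        InducesFree G (upSet (evenBase n)) ∧
        ((upSet (evenBase n)).card : ℝ) =
          2 ^ (n - 1) + (1 + δ n) * (n.choose (n / 2) : ℝ))) := by
  have h2 : ∀ n j : ℕ, j < n → PosetFree (bipartitePoset G A B hG) (levels n j 2) := he.1
  -- Without vertices the empty family would be a copy of the poset.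
  have hne : Nonempty V := by
    by_contra h
    rw [not_nonempty_iff] at h
    refine h2 1 0 one_pos ∅ (Finset.empty_subset _) ⟨Equiv.equivOfIsEmpty _ _, fun p => ?_⟩
    exact h.elim p
  have hodd := fun n (hn : Odd n) => inducesFree_upSet_oddBase G A B hG hAB h2 hn
  have heven := fun n (hn : Even n) (hn2 : 2 ≤ n) =>
    inducesFree_upSet_evenBase G A B hG hAB h2 hn hn2
  have hC : ∀ n : ℕ, (0 : ℝ) < n.choose (n / 2) := fun n => by
    exact_mod_cast Nat.choose_pos (Nat.div_le_self n 2)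
  refine ⟨⟨fun n => ((vex n G : ℝ) - 2 ^ (n - 1)) / n.choose (n / 2) - 1, ?_, fun n _ => ?_⟩,
    baseError, tendsto_baseError, fun n hn => ⟨hodd n hn, card_upSet_oddBase_eq hn⟩,
    fun n hn hn2 => ⟨heven n hn hn2, card_upSet_evenBase_eq hn hn2⟩⟩
  · have hlow : ∀ n : ℕ, 1 ≤ n →
        2 ^ (n - 1) + (1 + baseError n) * (n.choose (n / 2) : ℝ) ≤ vex n G := by
      intro n hn
      rcases Nat.even_or_odd n with h | h
      · have hn2 : 2 ≤ n := by
          obtain ⟨m, rfl⟩ := h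
          omega
        rw [← card_upSet_evenBase_eq h hn2]
        exact_mod_cast (isGreatest_vex n G).2 ⟨_, heven n h hn2, rfl⟩
      · rw [← card_upSet_oddBase_eq h]
        exact_mod_cast (isGreatest_vex n G).2 ⟨_, hodd n h, rfl⟩
    refine tendsto_order.2 ⟨fun a ha => ?_, fun a ha => ?_⟩
    · filter_upwards [tendsto_baseError.eventually_const_lt ha, eventually_ge_atTop 1] with n h hn
      refine h.trans_le ?_
      rw [le_sub_iff_add_le, le_div_iff₀ (hC n)]
      linarith [hlow n hn]
    · filter_upwards [eventually_vex_le G A B hG ha] with n h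
      rw [sub_lt_iff_lt_add, div_lt_iff₀ (hC n)]
      linarith
  · have := (hC n).ne'
    field_simp
    ring
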